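/- For $\xi\in\mathbb{R}^{2\times 2}$ let $0\le\lambda_1(\xi)\le\lambda_2(\xi)$ denote the singular values of $\xi$. A function $f:\mathbb{R}^{2\times2}\to\mathbb{R}\cup\{+\infty\}$ is called rank one convex if $f(tA+(1-t)B)\le t f(A)+(1-t)f(B)$ for all $t\in[0,1]$ and all $A,B$ with $\operatorname{rank}(A-B)\le 1$, and polyconvex if $f(\xi)=g(\xi,\det\xi)$ for some convex $g:\mathbb{R}^{2\times 2}\times\mathbb{R}\to\mathbb{R}\cup\{+\infty\}$. For $E\subseteq\mathbb{R}^{2\times2}$, the rank one convex hull $\mathrm{Rco}\,E$ (respectively the polyconvex hull $\mathrm{Pco}\,E$) is the set of all $\xi$ such that $f(\xi)\le 0$ for every rank one convex (respectively polyconvex) $f:\mathbb{R}^{2\times2}\to\mathbb{R}\cup\{+\infty\}$ with $f|_E\le 0$. **Theorem.** Let $K\subset\{(x,y)\in\mathbb{R}^2: 0\le x\le y\}$ be a non-empty compact set with $\min\{x:(x,y)\in K\}>0$, and let $$E=\{\xi\in\mathbb{R}^{2\times 2}: (\lambda_1(\xi),\lambda_2(\xi))\in K\},\qquad m(\theta)=\max_{(a,b)\in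 K}\{ab+\theta(b-a)\}.$$ Then $$\mathrm{Rco}\,E=\Big\{\xi\in\mathbb{R}^{2\times2}:\ \lambda_1(\xi)\lambda_2(\xi)+\theta(\lambda_2(\xi)-\lambda_1(\xi))\le m(\theta)\ \ \forall\,\theta\in[0,\max_{(a,b)\in K}b]\Big\},$$ $$\mathrm{int}\,\mathrm{Rco}\,E=\Big\{\xi\in\mathbb{R}^{2\times2}:\ \lambda_1(\xi)\lambda_2(\xi)+\theta(\lambda_2(\xi)-\lambda_1(\xi))< m(\theta)\ \ \forall\,\theta\in[0,\max_{(a,b)\in K}b]\Big\},$$ and $\mathrm{Rco}\,E=\mathrm{Pco}\,E$. -/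

import Mathlib

noncomputable section

namespace IsotropicHull

/-- Real two-by-two matrices. -/
abbrev Mat : Type := Matrix (Fin 2) (Fin 2) ℝ

/-- The larger singular value of `ξ` (Mathlib lists singular values in decreasing order). -/
def sing2 (ξ : Mat) : ℝ := (Matrix.toEuclideanLin ξ).singularValues 0

/-- The smaller singular value of `ξ`. -/
def sing1 (ξ : Mat) : ℝ := (Matrix.toEuclideanLin ξ).singularValues 1

/-- The isotropic set of the matrices whose ordered pair of singular values lies in `K`. -/
def isoSet (K : Set (ℝ × ℝ)) : Set Mat := {ξ | (sing1 ξ, sing2 ξ) ∈ K}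

/-- A function with values in `ℝ ∪ {+∞}` (an extended real function which never takes the
value `-∞`) that is convex along every segment whose direction has rank at most one. -/
def RankOneConvex (f : Mat → EReal) : Prop :=
  (∀ ξ, f ξ ≠ ⊥) ∧
    ∀ A B : Mat, (A - B).rank ≤ 1 → ∀ t : ℝ, 0 ≤ t → t ≤ 1 →
      f (t • A + (1 - t) • B) ≤ (t : EReal) * f A + ((1 - t : ℝ) : EReal) * f B

/-- Convexity of a function with values in `ℝ ∪ {+∞}`. -/
def ExtConvex {V : Type*} [AddCommGroup V] [Module ℝ V] (g : V → EReal) : Prop :=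
  (∀ v, g v ≠ ⊥) ∧
    ∀ v w : V, ∀ t : ℝ, 0 ≤ t → t ≤ 1 →
      g (t • v + (1 - t) • w) ≤ (t : EReal) * g v + ((1 - t : ℝ) : EReal) * g w

/-- A function `f` with values in `ℝ ∪ {+∞}` is polyconvex if `f ξ` is a convex function, with
values in `ℝ ∪ {+∞}`, of the minors of `ξ`, that is, of the pair `(ξ, det ξ)`. -/
def Polyconvex (f : Mat → EReal) : Prop :=
  ∃ g : Mat × ℝ → EReal, ExtConvex g ∧ ∀ ξ, f ξ = g (ξ, ξ.det)

/-- The rank one convex hull of a set of matrices. -/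
def Rco (E : Set Mat) : Set Mat :=
  {ξ | ∀ f : Mat → EReal, RankOneConvex f → (∀ η ∈ E, f η ≤ 0) → f ξ ≤ 0}

/-- The polyconvex hull of a set of matrices. -/
def Pco (E : Set Mat) : Set Mat :=
  {ξ | ∀ f : Mat → EReal, Polyconvex f → (∀ η ∈ E, f η ≤ 0) → f ξ ≤ 0}

/-- The maximum of `b` over the points `(a, b)` of `K`. -/
def maxB (K : Set (ℝ × ℝ)) : ℝ := sSup ((fun p : ℝ × ℝ => p.2) '' K)

/-- The maximum of `a * b + θ * (b - a)` over the points `(a, b)` of `K`. -/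
def maxM (K : Set (ℝ × ℝ)) (θ : ℝ) : ℝ :=
  sSup ((fun p : ℝ × ℝ => p.1 * p.2 + θ * (p.2 - p.1)) '' K)

end IsotropicHull

end

/-!
All four sets involved are described by the two quantities `λ₁ λ₂` and `λ₂ - λ₁`. Writing a matrix
as `v ↦ z v + w (conj v)` on `ℝ² = ℂ`, its singular values are `|z| + |w|` and `||z| - |w||`, and
its determinant is `|z|² - |w|²`; so where the determinant is nonnegative, `λ₁ λ₂ = det` and
`λ₂ - λ₁ = 2 |w|`.

*The hulls are contained in the set of inequalities.* Rank one convex hulls lie in polyconvex hulls,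
because the determinant is affine along rank one segments. For `θ ≥ 0` the functions
`det + 2 θ |w|` and `-det + 2 θ |z|` are polyconvex, and one of them equals
`λ₁ λ₂ + θ (λ₂ - λ₁)` at any given matrix. On `E` both are at most `m(θ)` (`isoSet_bound`): the
branch with the other sign is `-λ₁ λ₂ + θ (λ₁ + λ₂)`, which is bounded by the right branch if
`θ ≤ λ₂` and by `θ²` otherwise, and `θ² ≤ m(θ)` as long as `θ ≤ max b` (`sq_le_maxM`).

*The set of inequalities is contained in the rank one convex hull.* That hull is invariant under
orthogonal matrices on both sides, so by the singular value decomposition it is determined by a set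
of pairs `(x, y)`, here `hullPairs K`. Explicit rank one segments give two closure properties:
a pair `(a, b)` brings along all `(x, y)` with `y ≤ b` and `x y ≤ a b` (`hullPairs_of_le`), and two
pairs `(a, b)`, `(c, d)` with `a ≤ c`, `d ≤ b` bring along the pairs which lie between them in the
coordinates `(x y, y - x)` (`hullPairs_segment`). Given `(x, y)` satisfying the inequalities, each
`θ ∈ [0, y]` has a point of `K` at which the maximum `m(θ)` is attained, and this point has
`b ≥ y`, or `b ≤ y` and `a b ≥ x y`. Unless one point of `K` dominates `(x, y)`, both kinds occur,
and since `[0, y]` is connected there is a `θ` for which both kinds satisfy the inequality. The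
segment between two such points then contains a pair `(x', y)` with `x ≤ x'`
(`mem_hullPairs_of_two`).

*The interior.* The strict inequalities define an open set, by compactness of the range of `θ`.
Conversely `m(θ) > 0`, so that a point with equality leaves the hull when it is multiplied by any
factor greater than `1`.
-/

namespace IsotropicHull

open Matrix

/-! ### Singular values of real two-by-two matrices -/

theorem sing1_nonneg (ξ : Mat) : 0 ≤ sing1 ξ := LinearMap.singularValues_nonneg _ _

theorem sing1_le_sing2 (ξ : Mat) : sing1 ξ ≤ sing2 ξ :=
  LinearMap.singularValues_antitone _ zero_le_one

theorem sing2_nonneg (ξ : Mat) : 0 ≤ sing2 ξ := LinearMap.singularValues_nonneg _ _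

theorem adjoint_comp_toEuclideanLin (ξ : Mat) :
    LinearMap.adjoint (toEuclideanLin ξ) ∘ₗ toEuclideanLin ξ =
      toLin (PiLp.basisFun 2 ℝ (Fin 2)) (PiLp.basisFun 2 ℝ (Fin 2)) (ξᵀ * ξ) := by
  rw [← conjTranspose_eq_transpose_of_trivial, ← toEuclideanLin_conjTranspose_eq_adjoint,
    Matrix.toLin_mul _ (PiLp.basisFun 2 ℝ (Fin 2)), ← toLpLin_eq_toLin]

theorem sing1_mul_sing2 (ξ : Mat) : sing1 ξ * sing2 ξ = |ξ.det| := by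
  have hn : Module.finrank ℝ (EuclideanSpace ℝ (Fin 2)) = 2 := by simp
  have h := (toEuclideanLin ξ).isSymmetric_adjoint_comp_self.det_eq_prod_eigenvalues hn
  simp only [Fin.prod_univ_two, ← (toEuclideanLin ξ).sq_singularValues_fin hn] at h
  rw [adjoint_comp_toEuclideanLin, LinearMap.det_toLin, det_mul, det_transpose] at h
  rw [← abs_of_nonneg (mul_nonneg (sing1_nonneg ξ) (sing2_nonneg ξ)), ← sq_eq_sq_iff_abs_eq_abs,
    pow_two ξ.det, h, mul_pow]
  exact mul_comm _ _

theorem sing1_sq_add_sing2_sq (ξ : Mat) :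
    sing1 ξ ^ 2 + sing2 ξ ^ 2 = (ξᵀ * ξ).trace := by
  have hn : Module.finrank ℝ (EuclideanSpace ℝ (Fin 2)) = 2 := by simp
  have h := (toEuclideanLin ξ).isSymmetric_adjoint_comp_self.trace_eq_sum_eigenvalues hn
  simp only [Fin.sum_univ_two, ← (toEuclideanLin ξ).sq_singularValues_fin hn] at h
  rw [adjoint_comp_toEuclideanLin, Matrix.trace_toLin_eq] at h
  rw [h]
  exact add_comm _ _

theorem trace_transpose_mul_self (ξ : Mat) :
    (ξᵀ * ξ).trace = ξ 0 0 ^ 2 + ξ 0 1 ^ 2 + ξ 1 0 ^ 2 + ξ 1 1 ^ 2 := by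
  simp [Matrix.trace, Matrix.mul_apply, Fin.sum_univ_two]
  ring

theorem trace_eq_two_mul_det_add (ξ : Mat) :
    (ξᵀ * ξ).trace = 2 * ξ.det + ((ξ 0 0 - ξ 1 1) ^ 2 + (ξ 1 0 + ξ 0 1) ^ 2) := by
  rw [trace_transpose_mul_self, det_fin_two]
  ring

/-- The determinant is affine along rank one segments. -/
theorem det_segment {A B : Mat} (h : (A - B).det = 0) (t : ℝ) :
    (t • A + (1 - t) • B).det = t * A.det + (1 - t) * B.det := by
  have e : (t • A + (1 - t) • B).det =
      t * A.det + (1 - t) * B.det - t * (1 - t) * (A - B).det := by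
    simp [det_fin_two]
    ring
  rw [e, h, mul_zero, sub_zero]

/-- The singular values are the only ordered pair of nonnegative numbers with the right product and
the right sum of squares. -/
theorem sing_eq_of_abs_det_of_trace {ξ : Mat} {x y : ℝ} (hx : 0 ≤ x) (hxy : x ≤ y)
    (hdet : |ξ.det| = x * y) (htr : (ξᵀ * ξ).trace = x ^ 2 + y ^ 2) :
    sing1 ξ = x ∧ sing2 ξ = y := by
  rw [← sing1_mul_sing2] at hdet
  rw [← sing1_sq_add_sing2_sq] at htr
  have h1 := sing1_nonneg ξ
  have h2 := sing1_le_sing2 ξ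
  have hs : sing2 ξ + sing1 ξ = y + x := by
    rw [← sq_eq_sq₀ (by linarith) (by linarith)]; linarith
  have hd : sing2 ξ - sing1 ξ = y - x := by
    rw [← sq_eq_sq₀ (by linarith) (by linarith)]; linarith
  constructor <;> linarith

theorem sing_mul_orthogonal (ξ : Mat) {P Q : Mat} (hP : P ∈ orthogonalGroup (Fin 2) ℝ)
    (hQ : Q ∈ orthogonalGroup (Fin 2) ℝ) :
    sing1 (P * ξ * Q) = sing1 ξ ∧ sing2 (P * ξ * Q) = sing2 ξ := by
  have hP' : Pᵀ * P = 1 := (mem_orthogonalGroup_iff' _ _).1 hP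
  have hQ' : Q * Qᵀ = 1 := (mem_orthogonalGroup_iff _ _).1 hQ
  have hPd : |P.det| = 1 := by
    rw [← abs_one, ← sq_eq_sq_iff_abs_eq_abs, one_pow, ← det_one (n := Fin 2), ← hP', det_mul,
      det_transpose, pow_two]
  have hQd : |Q.det| = 1 := by
    rw [← abs_one, ← sq_eq_sq_iff_abs_eq_abs, one_pow, ← det_one (n := Fin 2), ← hQ', det_mul,
      det_transpose, pow_two]
  refine sing_eq_of_abs_det_of_trace (sing1_nonneg ξ) (sing1_le_sing2 ξ) ?_ ?_
  · rw [det_mul, det_mul, abs_mul, abs_mul, hPd, hQd, sing1_mul_sing2, one_mul, mul_one]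
  · rw [sing1_sq_add_sing2_sq]
    calc ((P * ξ * Q)ᵀ * (P * ξ * Q)).trace
        = (Qᵀ * (ξᵀ * (Pᵀ * P) * ξ) * Q).trace := by
          simp only [transpose_mul, Matrix.mul_assoc]
      _ = (ξᵀ * ξ).trace := by
          rw [hP', Matrix.mul_one, Matrix.trace_mul_comm, ← Matrix.mul_assoc, hQ', Matrix.one_mul]

theorem rank_le_one_iff_det_eq_zero (A : Mat) : A.rank ≤ 1 ↔ A.det = 0 := by
  constructor
  · intro h
    by_contra hd
    have := Matrix.rank_of_isUnit A ((Matrix.isUnit_iff_isUnit_det A).2 (isUnit_iff_ne_zero.2 hd))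
    simp at this
    omega
  · intro h
    obtain ⟨v, hv, hAv⟩ := Matrix.exists_mulVec_eq_zero_iff.2 h
    have hk := LinearMap.finrank_range_add_finrank_ker A.mulVecLin
    have : 0 < Module.finrank ℝ (LinearMap.ker A.mulVecLin) := by
      rw [Module.finrank_pos_iff_exists_ne_zero]
      exact ⟨⟨v, by simpa using hAv⟩, by simpa [Subtype.ext_iff] using hv⟩
    simp at hk
    rw [Matrix.rank]
    omega

/-- The rotation by the angle `φ`. -/
noncomputable def rot (φ : ℝ) : Mat := !![Real.cos φ, -Real.sin φ; Real.sin φ, Real.cos φ]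

theorem rot_mem (φ : ℝ) : rot φ ∈ orthogonalGroup (Fin 2) ℝ := by
  rw [mem_orthogonalGroup_iff]
  ext i j
  have := Real.sin_sq_add_cos_sq φ
  fin_cases i <;> fin_cases j <;> simp [rot, Matrix.mul_apply, Fin.sum_univ_two] <;> linarith

/-! ### Conformal and anticonformal parts -/

/-- The conformal part of a matrix, as a complex number: under `ℝ² = ℂ` every matrix acts as
`v ↦ z * v + w * conj v`, and this is `z`. -/
noncomputable def confPart : Mat →ₗ[ℝ] ℂ where
  toFun ξ := ⟨(ξ 0 0 + ξ 1 1) / 2, (ξ 1 0 - ξ 0 1) / 2⟩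
  map_add' ξ η := by apply Complex.ext <;> simp <;> ring
  map_smul' t ξ := by apply Complex.ext <;> simp <;> ring

/-- The anticonformal part of a matrix: the number `w` in `v ↦ z * v + w * conj v`. -/
noncomputable def antiPart : Mat →ₗ[ℝ] ℂ where
  toFun ξ := ⟨(ξ 0 0 - ξ 1 1) / 2, (ξ 1 0 + ξ 0 1) / 2⟩
  map_add' ξ η := by apply Complex.ext <;> simp <;> ring
  map_smul' t ξ := by apply Complex.ext <;> simp <;> ring

theorem norm_confPart_sq (ξ : Mat) :
    ‖confPart ξ‖ ^ 2 = ((ξ 0 0 + ξ 1 1) / 2) ^ 2 + ((ξ 1 0 - ξ 0 1) / 2) ^ 2 := by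
  rw [← Complex.normSq_eq_norm_sq, Complex.normSq_apply]
  simp only [confPart, LinearMap.coe_mk, AddHom.coe_mk]
  ring

theorem norm_antiPart_sq (ξ : Mat) :
    ‖antiPart ξ‖ ^ 2 = ((ξ 0 0 - ξ 1 1) / 2) ^ 2 + ((ξ 1 0 + ξ 0 1) / 2) ^ 2 := by
  rw [← Complex.normSq_eq_norm_sq, Complex.normSq_apply]
  simp only [antiPart, LinearMap.coe_mk, AddHom.coe_mk]
  ring

theorem det_eq_norm_sq_sub (ξ : Mat) : ξ.det = ‖confPart ξ‖ ^ 2 - ‖antiPart ξ‖ ^ 2 := by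
  rw [norm_confPart_sq, norm_antiPart_sq, det_fin_two]
  ring

/-- The singular values are the sum and the distance of the moduli of the two parts. -/
theorem sing_eq_norm_parts (ξ : Mat) :
    sing1 ξ = |‖confPart ξ‖ - ‖antiPart ξ‖| ∧ sing2 ξ = ‖confPart ξ‖ + ‖antiPart ξ‖ := by
  have hc := norm_nonneg (confPart ξ)
  have ha := norm_nonneg (antiPart ξ)
  refine sing_eq_of_abs_det_of_trace (abs_nonneg _)
    (abs_sub_le_iff.2 ⟨by linarith, by linarith⟩) ?_ ?_
  · rw [det_eq_norm_sq_sub, sq_sub_sq, abs_mul, abs_of_nonneg (add_nonneg hc ha), mul_comm]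
  · rw [sq_abs, trace_transpose_mul_self]
    linarith [norm_confPart_sq ξ, norm_antiPart_sq ξ]

theorem sing1_of_det_nonneg {ξ : Mat} (h : 0 ≤ ξ.det) : sing1 ξ = ‖confPart ξ‖ - ‖antiPart ξ‖ := by
  rw [(sing_eq_norm_parts ξ).1, abs_of_nonneg]
  rw [det_eq_norm_sq_sub, sub_nonneg, sq_le_sq₀ (norm_nonneg _) (norm_nonneg _)] at h
  linarith

theorem sing1_of_det_nonpos {ξ : Mat} (h : ξ.det ≤ 0) : sing1 ξ = ‖antiPart ξ‖ - ‖confPart ξ‖ := by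
  rw [(sing_eq_norm_parts ξ).1, abs_of_nonpos, neg_sub]
  rw [det_eq_norm_sq_sub, sub_nonpos, sq_le_sq₀ (norm_nonneg _) (norm_nonneg _)] at h
  linarith

theorem sing_smul (ξ : Mat) {t : ℝ} (ht : 0 ≤ t) :
    sing1 (t • ξ) = t * sing1 ξ ∧ sing2 (t • ξ) = t * sing2 ξ := by
  rw [(sing_eq_norm_parts (t • ξ)).1, (sing_eq_norm_parts (t • ξ)).2, (sing_eq_norm_parts ξ).1,
    (sing_eq_norm_parts ξ).2, map_smul, map_smul, norm_smul, norm_smul, Real.norm_of_nonneg ht,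
    ← mul_sub, ← mul_add, abs_mul, abs_of_nonneg ht]
  exact ⟨rfl, rfl⟩

theorem continuous_sing1 : Continuous sing1 := by
  have h : sing1 = fun ξ => |‖confPart ξ‖ - ‖antiPart ξ‖| :=
    funext fun ξ => (sing_eq_norm_parts ξ).1
  rw [h]
  exact (confPart.continuous_of_finiteDimensional.norm.sub
    antiPart.continuous_of_finiteDimensional.norm).abs

theorem continuous_sing2 : Continuous sing2 := by
  have h : sing2 = fun ξ => ‖confPart ξ‖ + ‖antiPart ξ‖ :=
    funext fun ξ => (sing_eq_norm_parts ξ).2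
  rw [h]
  exact confPart.continuous_of_finiteDimensional.norm.add
    antiPart.continuous_of_finiteDimensional.norm

/-- The singular value decomposition. The two rotations come from half the sum and half the
difference of the arguments of the conformal and the anticonformal part; a reflection corrects the
sign when the determinant is negative. -/
theorem exists_svd (ξ : Mat) : ∃ P ∈ orthogonalGroup (Fin 2) ℝ, ∃ Q ∈ orthogonalGroup (Fin 2) ℝ,
    ξ = P * !![sing2 ξ, 0; 0, sing1 ξ] * Q := by
  obtain ⟨e1, e2⟩ := sing_eq_norm_parts ξ
  obtain ⟨φ, ψ, hA, hB⟩ : ∃ φ ψ : ℝ, (confPart ξ).arg = φ + ψ ∧ (antiPart ξ).arg = φ - ψ :=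
    ⟨((confPart ξ).arg + (antiPart ξ).arg) / 2, ((confPart ξ).arg - (antiPart ξ).arg) / 2,
      by ring, by ring⟩
  have h1 := Complex.norm_mul_cos_arg (confPart ξ)
  have h2 := Complex.norm_mul_sin_arg (confPart ξ)
  have h3 := Complex.norm_mul_cos_arg (antiPart ξ)
  have h4 := Complex.norm_mul_sin_arg (antiPart ξ)
  rw [hA, Real.cos_add] at h1
  rw [hA, Real.sin_add] at h2
  rw [hB, Real.cos_sub] at h3
  rw [hB, Real.sin_sub] at h4
  set α := ‖confPart ξ‖
  set β := ‖antiPart ξ‖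
  simp only [confPart, antiPart, LinearMap.coe_mk, AddHom.coe_mk] at h1 h2 h3 h4
  have key : ξ = rot φ * !![α + β, 0; 0, α - β] * rot ψ := by
    ext i j
    fin_cases i <;> fin_cases j <;>
      simp [rot, Matrix.mul_apply, Fin.sum_univ_two] <;> linarith
  rcases le_total β α with h | h
  · exact ⟨rot φ, rot_mem φ, rot ψ, rot_mem ψ, by
      rw [e1, e2, abs_of_nonneg (sub_nonneg.2 h)]; exact key⟩
  · have hS : !![1, 0; 0, -1] ∈ orthogonalGroup (Fin 2) ℝ := by
      rw [mem_orthogonalGroup_iff]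
      ext i j
      fin_cases i <;> fin_cases j <;> simp [Matrix.mul_apply, Fin.sum_univ_two]
    refine ⟨rot φ * !![1, 0; 0, -1], mul_mem (rot_mem φ) hS, rot ψ, rot_mem ψ, ?_⟩
    have hd : !![α + β, 0; 0, α - β] = (!![1, 0; 0, -1] : Mat) * !![α + β, 0; 0, β - α] := by
      ext i j
      fin_cases i <;> fin_cases j <;> simp [Matrix.mul_apply, Fin.sum_univ_two]
    rw [e1, e2, abs_of_nonpos (sub_nonpos.2 h), neg_sub, Matrix.mul_assoc (rot φ), ← hd]
    exact key

/-! ### Rank one convex hulls -/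

theorem subset_Rco (E : Set Mat) : E ⊆ Rco E := fun _ hξ _ _ hE => hE _ hξ

theorem ereal_combo_nonpos {x y : EReal} (hx : x ≤ 0) (hy : y ≤ 0) {t : ℝ} (h0 : 0 ≤ t)
    (h1 : t ≤ 1) : (t : EReal) * x + ((1 - t : ℝ) : EReal) * y ≤ 0 :=
  add_nonpos (EReal.mul_nonpos_iff.2 (.inl ⟨EReal.coe_nonneg.2 h0, hx⟩))
    (EReal.mul_nonpos_iff.2 (.inl ⟨EReal.coe_nonneg.2 (sub_nonneg.2 h1), hy⟩))

theorem Rco_segment {E : Set Mat} {A B : Mat} (hA : A ∈ Rco E) (hB : B ∈ Rco E)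
    (hAB : (A - B).det = 0) {t : ℝ} (h0 : 0 ≤ t) (h1 : t ≤ 1) :
    t • A + (1 - t) • B ∈ Rco E := fun f hf hE =>
  (hf.2 A B ((rank_le_one_iff_det_eq_zero _).2 hAB) t h0 h1).trans
    (ereal_combo_nonpos (hA f hf hE) (hB f hf hE) h0 h1)

theorem RankOneConvex.comp_mul {f : Mat → EReal} (hf : RankOneConvex f) (P Q : Mat) :
    RankOneConvex fun ξ => f (P * ξ * Q) := by
  refine ⟨fun ξ => hf.1 _, fun A B h t h0 h1 => ?_⟩
  have h' : (P * A * Q - P * B * Q).rank ≤ 1 := by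
    rw [rank_le_one_iff_det_eq_zero] at h ⊢
    rw [← Matrix.sub_mul, ← Matrix.mul_sub, det_mul, det_mul, h, mul_zero, zero_mul]
  simpa only [Matrix.mul_add, Matrix.add_mul, Matrix.mul_smul, Matrix.smul_mul] using
    hf.2 _ _ h' t h0 h1

theorem mul_mem_Rco_isoSet {K : Set (ℝ × ℝ)} {ξ : Mat} (hξ : ξ ∈ Rco (isoSet K)) {P Q : Mat}
    (hP : P ∈ orthogonalGroup (Fin 2) ℝ) (hQ : Q ∈ orthogonalGroup (Fin 2) ℝ) :
    P * ξ * Q ∈ Rco (isoSet K) := by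
  intro f hf hE
  refine hξ _ (hf.comp_mul P Q) fun η hη => hE _ ?_
  rw [isoSet, Set.mem_ofPred_eq] at hη ⊢
  rwa [(sing_mul_orthogonal η hP hQ).1, (sing_mul_orthogonal η hP hQ).2]

theorem mem_Rco_isoSet_of_sing_eq {K : Set (ℝ × ℝ)} {ξ η : Mat} (hξ : ξ ∈ Rco (isoSet K))
    (h1 : sing1 η = sing1 ξ) (h2 : sing2 η = sing2 ξ) : η ∈ Rco (isoSet K) := by
  obtain ⟨P, hP, Q, hQ, e⟩ := exists_svd ξ
  obtain ⟨P', hP', Q', hQ', e'⟩ := exists_svd η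
  have hPP : Pᵀ * P = 1 := (mem_orthogonalGroup_iff' _ _).1 hP
  have hQQ : Q * Qᵀ = 1 := (mem_orthogonalGroup_iff _ _).1 hQ
  have hd : !![sing2 η, 0; 0, sing1 η] = Pᵀ * ξ * Qᵀ := by
    rw [h1, h2]
    conv_rhs => rw [e]
    rw [Matrix.mul_assoc, Matrix.mul_assoc, hQQ, Matrix.mul_one, ← Matrix.mul_assoc, hPP,
      Matrix.one_mul]
  rw [e', hd]
  exact mul_mem_Rco_isoSet (mul_mem_Rco_isoSet hξ (Unitary.star_mem hP) (Unitary.star_mem hQ))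
    hP' hQ'

/-! ### The pairs of singular values in the hull -/

/-- The pairs `(x, y)` such that every matrix with singular values `x ≤ y` lies in the rank one
convex hull of `isoSet K`. -/
def hullPairs (K : Set (ℝ × ℝ)) : Set (ℝ × ℝ) :=
  {p | ∀ ξ : Mat, sing1 ξ = p.1 → sing2 ξ = p.2 → ξ ∈ Rco (isoSet K)}

theorem subset_hullPairs (K : Set (ℝ × ℝ)) : K ⊆ hullPairs K := fun p hp ξ h1 h2 =>
  subset_Rco _ (by rw [isoSet, Set.mem_ofPred_eq, h1, h2]; exact hp)

theorem sing_diag {x y : ℝ} (hx : 0 ≤ x) (hxy : x ≤ y) :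
    sing1 !![x, 0; 0, y] = x ∧ sing2 !![x, 0; 0, y] = y :=
  sing_eq_of_abs_det_of_trace hx hxy
    (by rw [det_fin_two_of, mul_zero, sub_zero, abs_of_nonneg (mul_nonneg hx (hx.trans hxy))])
    (by rw [trace_transpose_mul_self]; simp)

theorem mem_hullPairs_of_mem_Rco {K : Set (ℝ × ℝ)} {ξ : Mat} (h : ξ ∈ Rco (isoSet K)) :
    (sing1 ξ, sing2 ξ) ∈ hullPairs K := fun _ e1 e2 => mem_Rco_isoSet_of_sing_eq h e1 e2

theorem mem_hullPairs_iff_diag {K : Set (ℝ × ℝ)} {x y : ℝ} (hx : 0 ≤ x) (hxy : x ≤ y) :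
    (x, y) ∈ hullPairs K ↔ !![x, 0; 0, y] ∈ Rco (isoSet K) := by
  obtain ⟨e1, e2⟩ := sing_diag hx hxy
  refine ⟨fun h => h _ e1 e2, fun h => ?_⟩
  simpa only [e1, e2] using mem_hullPairs_of_mem_Rco h

theorem diag_comm_mem {K : Set (ℝ × ℝ)} {p q : ℝ} (h : !![p, 0; 0, q] ∈ Rco (isoSet K)) :
    !![q, 0; 0, p] ∈ Rco (isoSet K) := by
  have hJ : !![0, 1; 1, 0] ∈ orthogonalGroup (Fin 2) ℝ := by
    rw [mem_orthogonalGroup_iff]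
    ext i j
    fin_cases i <;> fin_cases j <;> simp [Matrix.mul_apply, Fin.sum_univ_two]
  simpa [Matrix.mul_fin_two] using mul_mem_Rco_isoSet h hJ hJ

theorem diag_neg_mem {K : Set (ℝ × ℝ)} {p q : ℝ} (h : !![p, 0; 0, q] ∈ Rco (isoSet K)) :
    !![-p, 0; 0, q] ∈ Rco (isoSet K) := by
  have hS : !![-1, 0; 0, 1] ∈ orthogonalGroup (Fin 2) ℝ := by
    rw [mem_orthogonalGroup_iff]
    ext i j
    fin_cases i <;> fin_cases j <;> simp [Matrix.mul_apply, Fin.sum_univ_two]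
  simpa [Matrix.mul_fin_two] using mul_mem_Rco_isoSet h hS (one_mem _)

/-- A nonnegative diagonal entry can be decreased: the matrix lies between the two matrices with
that entry equal to `p` and to `-p`. -/
theorem diag_mem_of_le {K : Set (ℝ × ℝ)} {p q x : ℝ} (h : !![p, 0; 0, q] ∈ Rco (isoSet K))
    (hx : 0 ≤ x) (hxp : x ≤ p) : !![x, 0; 0, q] ∈ Rco (isoSet K) := by
  rcases (hx.trans hxp).eq_or_lt with rfl | hp
  · rwa [le_antisymm hxp hx]
  have e : ((p + x) / (2 * p)) • !![p, 0; 0, q] + (1 - (p + x) / (2 * p)) • !![-p, 0; 0, q] =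
      !![x, 0; 0, q] := by
    ext i j
    fin_cases i <;> fin_cases j <;> simp <;> field_simp <;> ring
  rw [← e]
  exact Rco_segment h (diag_neg_mem h) (by simp [det_fin_two]) (by positivity)
    (by rw [div_le_one (by positivity)]; linarith)

/-- The singular values can be moved together with their product fixed: `diag(x, y)` is the midpoint
of two triangular matrices with off-diagonal entries `± s`, where `s` is chosen to give them the
singular values `a` and `b`. -/
theorem hullPairs_mul_eq {K : Set (ℝ × ℝ)} {a b x y : ℝ} (h : (a, b) ∈ hullPairs K) (ha : 0 ≤ a)
    (hax : a ≤ x) (hxy : x ≤ y) (hyb : y ≤ b) (hmul : x * y = a * b) : (x, y) ∈ hullPairs K := by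
  have hdiff : 0 ≤ (b - a) ^ 2 - (y - x) ^ 2 := by
    rw [sub_nonneg, sq_le_sq₀] <;> linarith
  have hs := Real.sq_sqrt hdiff
  set s := √((b - a) ^ 2 - (y - x) ^ 2)
  have hx : 0 ≤ x := ha.trans hax
  have hP : ∀ s' : ℝ, s' ^ 2 = s ^ 2 → sing1 !![x, s'; 0, y] = a ∧ sing2 !![x, s'; 0, y] = b :=
    fun s' hs' => sing_eq_of_abs_det_of_trace ha (by linarith)
      (by rw [det_fin_two_of, mul_zero, sub_zero, abs_of_nonneg (by nlinarith), hmul])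
      (by rw [trace_transpose_mul_self]; simp; linarith)
  obtain ⟨p1, p2⟩ := hP s rfl
  obtain ⟨q1, q2⟩ := hP (-s) (neg_sq s)
  rw [mem_hullPairs_iff_diag hx hxy]
  have e : (1 / 2 : ℝ) • !![x, s; 0, y] + (1 - 1 / 2 : ℝ) • !![x, -s; 0, y] = !![x, 0; 0, y] := by
    ext i j
    fin_cases i <;> fin_cases j <;> simp <;> ring
  rw [← e]
  exact Rco_segment (h _ p1 p2) (h _ q1 q2) (by simp [det_fin_two]) (by norm_num) (by norm_num)

/-- The hull of one pair `(a, b)`: first move down the curve of constant product to height `y` or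
to the diagonal, then decrease the diagonal entries. -/
theorem hullPairs_of_le {K : Set (ℝ × ℝ)} {a b x y : ℝ} (h : (a, b) ∈ hullPairs K) (ha : 0 < a)
    (hab : a ≤ b) (hx : 0 ≤ x) (hxy : x ≤ y) (hyb : y ≤ b) (hmul : x * y ≤ a * b) :
    (x, y) ∈ hullPairs K := by
  have hab0 : 0 < a * b := mul_pos ha (ha.trans_le hab)
  rw [mem_hullPairs_iff_diag hx hxy]
  rcases le_total (a * b) (y ^ 2) with hm | hm
  · have hy : 0 < y := (hx.trans hxy).lt_of_ne (by rintro rfl; linarith)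
    have h1 : a ≤ a * b / y := by rw [le_div_iff₀ hy]; gcongr
    have h2 : a * b / y ≤ y := by rw [div_le_iff₀ hy]; linarith
    refine diag_mem_of_le (p := a * b / y) ?_ hx (by rwa [le_div_iff₀ hy])
    rw [← mem_hullPairs_iff_diag (ha.le.trans h1) h2]
    exact hullPairs_mul_eq h ha.le h1 h2 hyb (by field_simp)
  · have hr := Real.sq_sqrt hab0.le
    have hyr : y ≤ √(a * b) := Real.le_sqrt_of_sq_le hm
    have har : a ≤ √(a * b) := Real.le_sqrt_of_sq_le (by nlinarith)
    have hrb : √(a * b) ≤ b := Real.sqrt_le_iff.2 ⟨ha.le.trans hab, by nlinarith⟩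
    have hrr : !![√(a * b), 0; 0, √(a * b)] ∈ Rco (isoSet K) := by
      rw [← mem_hullPairs_iff_diag (Real.sqrt_nonneg _) le_rfl]
      exact hullPairs_mul_eq h ha.le har le_rfl hrb (by rw [← pow_two, hr])
    exact diag_comm_mem (diag_mem_of_le (diag_comm_mem
      (diag_mem_of_le hrr hx (hxy.trans hyr))) (hx.trans hxy) hyr)

/-- A rank one segment between two pairs. The anticonformal parts of the end points `A`, `B` are the
nonnegative reals `(b - a) / 2` and `(d - c) / 2`, and the conformal parts have moduli
`(a + b) / 2` and `(c + d) / 2`. That `A - B` is singular means that the conformal parts are at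
distance `|(b - a) - (d - c)| / 2`, and the triangle with these sides exists because `a ≤ c` and
`d ≤ b`. Along the segment both the determinant and the anticonformal part are affine. -/
theorem hullPairs_segment {K : Set (ℝ × ℝ)} {a b c d x y t : ℝ} (hp : (a, b) ∈ hullPairs K)
    (hq : (c, d) ∈ hullPairs K) (ha : 0 < a) (hab : a ≤ b) (hcd : c ≤ d) (hac : a ≤ c)
    (hdb : d ≤ b) (h0 : 0 ≤ t) (h1 : t ≤ 1) (hx : 0 ≤ x) (hxy : x ≤ y)
    (hmul : x * y = t * (a * b) + (1 - t) * (c * d))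
    (hsub : y - x = t * (b - a) + (1 - t) * (d - c)) : (x, y) ∈ hullPairs K := by
  have hs : 0 < a + b := by linarith
  -- `r` and `s` are the real and imaginary part of the conformal part of `B`; `r` comes from the
  -- law of cosines
  obtain ⟨r, hr⟩ : ∃ r : ℝ, (a + b) * r = a * b + c * d + (b - a) * (d - c) / 2 :=
    ⟨_, mul_div_cancel₀ _ hs.ne'⟩
  have hrs : 0 ≤ (c + d) ^ 2 / 4 - r ^ 2 := by
    have e1 : (a + b) * ((c + d) / 2 - r) = (b - d) * (c - a) := by linarith
    have e2 : (a + b) * ((c + d) / 2 + r) = (b + c) * (a + d) := by linarith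
    have l1 : 0 ≤ (c + d) / 2 - r := nonneg_of_mul_nonneg_right
      (e1 ▸ mul_nonneg (sub_nonneg.2 hdb) (sub_nonneg.2 hac)) hs
    have l2 : 0 ≤ (c + d) / 2 + r := nonneg_of_mul_nonneg_right
      (e2 ▸ mul_nonneg (by linarith) (by linarith)) hs
    linarith [mul_nonneg l1 l2]
  obtain ⟨s, hs'⟩ : ∃ s : ℝ, s ^ 2 = (c + d) ^ 2 / 4 - r ^ 2 := ⟨_, Real.sq_sqrt hrs⟩
  set A : Mat := !![b, 0; 0, a] with hA
  set B : Mat := !![r + (d - c) / 2, -s; s, r - (d - c) / 2] with hB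
  have hdetB : B.det = c * d := by
    rw [hB, det_fin_two_of]; linarith
  have hdetA : A.det = a * b := by
    rw [hA, det_fin_two_of]; ring
  have hAB : (A - B).det = 0 := by
    simp [hA, hB, det_fin_two]
    linarith
  have hA' : sing1 A = a ∧ sing2 A = b :=
    sing_eq_of_abs_det_of_trace ha.le hab (by rw [hdetA, abs_of_nonneg (by nlinarith)])
      (by rw [trace_transpose_mul_self]; simp [hA]; ring)
  have hB' : sing1 B = c ∧ sing2 B = d :=
    sing_eq_of_abs_det_of_trace (by linarith) hcd (by rw [hdetB, abs_of_nonneg (by nlinarith)])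
      (by rw [trace_transpose_mul_self]; simp [hB]; linarith)
  have hdetM : (t • A + (1 - t) • B).det = x * y := by
    rw [det_segment hAB, hdetA, hdetB, hmul]
  have hM : sing1 (t • A + (1 - t) • B) = x ∧ sing2 (t • A + (1 - t) • B) = y :=
    sing_eq_of_abs_det_of_trace hx hxy (by rw [hdetM, abs_of_nonneg (by nlinarith)]) (by
      rw [trace_eq_two_mul_det_add, hdetM]
      have e1 : (t • A + (1 - t) • B) 0 0 - (t • A + (1 - t) • B) 1 1 = y - x := by
        simp [hA, hB]; linarith
      have e2 : (t • A + (1 - t) • B) 1 0 + (t • A + (1 - t) • B) 0 1 = 0 := by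
        simp [hA, hB]
      rw [e1, e2]; ring)
  have := mem_hullPairs_of_mem_Rco (Rco_segment (hp A hA'.1 hA'.2) (hq B hB'.1 hB'.2) hAB h0 h1)
  rwa [hM.1, hM.2] at this

/-! ### Points satisfying the inequalities lie in the rank one convex hull -/

theorem le_maxB {K : Set (ℝ × ℝ)} (hK : IsCompact K) {p : ℝ × ℝ} (hp : p ∈ K) : p.2 ≤ maxB K :=
  le_csSup (hK.image continuous_snd).bddAbove ⟨p, hp, rfl⟩

theorem exists_eq_maxB {K : Set (ℝ × ℝ)} (hK : IsCompact K) (hne : K.Nonempty) :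
    ∃ p ∈ K, p.2 = maxB K :=
  (hK.image continuous_snd).sSup_mem (hne.image _)

theorem le_maxM {K : Set (ℝ × ℝ)} (hK : IsCompact K) {p : ℝ × ℝ} (hp : p ∈ K) (θ : ℝ) :
    p.1 * p.2 + θ * (p.2 - p.1) ≤ maxM K θ :=
  le_csSup (hK.image (by fun_prop : Continuous fun p : ℝ × ℝ =>
    p.1 * p.2 + θ * (p.2 - p.1))).bddAbove ⟨p, hp, rfl⟩

theorem exists_eq_maxM {K : Set (ℝ × ℝ)} (hK : IsCompact K) (hne : K.Nonempty) (θ : ℝ) :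
    ∃ p ∈ K, p.1 * p.2 + θ * (p.2 - p.1) = maxM K θ :=
  (hK.image (by fun_prop : Continuous fun p : ℝ × ℝ =>
    p.1 * p.2 + θ * (p.2 - p.1))).sSup_mem (hne.image _)

theorem continuous_maxM {K : Set (ℝ × ℝ)} (hK : IsCompact K) : Continuous (maxM K) :=
  hK.continuous_sSup (f := fun θ p => p.1 * p.2 + θ * (p.2 - p.1)) (by fun_prop)

/-- A point of `K` of maximal height gives this bound, as
`a b + θ (b - a) - θ ^ 2 = (a + θ) (b - θ)`. -/
theorem sq_le_maxM {K : Set (ℝ × ℝ)} (hK : IsCompact K) (hne : K.Nonempty)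
    (hpos : ∀ p ∈ K, 0 < p.1) {θ : ℝ} (hθ : θ ∈ Set.Icc 0 (maxB K)) : θ ^ 2 ≤ maxM K θ := by
  obtain ⟨p, hp, e⟩ := exists_eq_maxB hK hne
  have h1 := le_maxM hK hp θ
  have h2 : 0 ≤ (p.1 + θ) * (p.2 - θ) :=
    mul_nonneg (add_nonneg (hpos p hp).le hθ.1) (sub_nonneg.2 (e ▸ hθ.2))
  linarith

theorem maxM_pos {K : Set (ℝ × ℝ)} (hK : IsCompact K) (hne : K.Nonempty)
    (hT : ∀ p ∈ K, 0 ≤ p.1 ∧ p.1 ≤ p.2) (hpos : ∀ p ∈ K, 0 < p.1) {θ : ℝ} (hθ : 0 ≤ θ) :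
    0 < maxM K θ := by
  obtain ⟨p, hp⟩ := hne
  have h1 := hpos p hp
  have h2 := (hT p hp).2
  exact (add_pos_of_pos_of_nonneg (mul_pos h1 (h1.trans_le h2))
    (mul_nonneg hθ (sub_nonneg.2 h2))).trans_le (le_maxM hK hp θ)

theorem maxM_maxB {K : Set (ℝ × ℝ)} (hK : IsCompact K) (hne : K.Nonempty)
    (hpos : ∀ p ∈ K, 0 < p.1) (hB : 0 ≤ maxB K) : maxM K (maxB K) ≤ maxB K ^ 2 := by
  obtain ⟨p, hp, e⟩ := exists_eq_maxM hK hne (maxB K)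
  have := mul_nonneg (add_nonneg (hpos p hp).le hB) (sub_nonneg.2 (le_maxB hK hp))
  linarith

/-- Two pairs, of heights above and below `y`, that satisfy the inequality for a common slope `θ`
bring `(x, y)` into the hull. If neither pair dominates `(x, y)`, there is a slope `σ` at which
their affine functions agree, and their common value at `σ` is still large enough. The rank one segment
between the pairs is the arc of the hyperbola `(x + σ) (y - σ) = (c + σ) (d - σ)`, whose point at
height `y` dominates `(x, y)`. -/
theorem mem_hullPairs_of_two {K : Set (ℝ × ℝ)} {a b c d x y θ : ℝ}
    (hp : (a, b) ∈ hullPairs K) (hq : (c, d) ∈ hullPairs K) (ha : 0 < a) (hab : a ≤ b)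
    (hc : 0 < c) (hcd : c ≤ d) (hx : 0 ≤ x) (hxy : x ≤ y) (hyb : y ≤ b) (hdy : d ≤ y)
    (hθy : θ ≤ y) (hxq : x * y ≤ c * d)
    (hpθ : x * y + θ * (y - x) ≤ a * b + θ * (b - a))
    (hqθ : x * y + θ * (y - x) ≤ c * d + θ * (d - c)) : (x, y) ∈ hullPairs K := by
  rcases le_or_gt (x * y) (a * b) with h | hlt
  · exact hullPairs_of_le hp ha hab hx hxy hyb h
  rcases hdy.eq_or_lt with rfl | hdy
  · exact hullPairs_of_le hq hc hcd hx hxy le_rfl hxq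
  have hac : a < c := by
    have h : a * b < c * b := by
      linarith [mul_le_mul_of_nonneg_left (hdy.le.trans hyb) hc.le]
    exact lt_of_mul_lt_mul_right h (ha.le.trans hab)
  have hD : 0 < (b - a) - (d - c) := by linarith
  -- the slope at which the affine functions of `(a, b)` and `(c, d)` agree
  obtain ⟨σ, hσ⟩ : ∃ σ : ℝ, σ * ((b - a) - (d - c)) = c * d - a * b :=
    ⟨_, div_mul_cancel₀ _ hD.ne'⟩
  have hσ0 : 0 < σ := pos_of_mul_pos_left (by rw [hσ]; linarith) hD.le
  have hdσ : σ < d := by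
    have h : 0 < (b - d) * (d + a) := mul_pos (by linarith) (by linarith)
    refine lt_of_mul_lt_mul_right (a := (b - a) - (d - c)) ?_ hD.le
    linarith
  have hlow : x * y + σ * (y - x) ≤ c * d + σ * (d - c) := by
    -- interpolate for `(c, d)` between `0` and `θ`, or for `(a, b)` between `θ` and `y`
    rcases le_total σ θ with h | h
    · have h1 := mul_nonneg hσ0.le (sub_nonneg.2 hqθ)
      have h2 := mul_nonneg (sub_nonneg.2 h) (sub_nonneg.2 hxq)
      refine le_of_mul_le_mul_left ?_ (hσ0.trans_le h)
      linarith
    · have h1 := mul_nonneg (by linarith : 0 ≤ y - σ) (sub_nonneg.2 hpθ)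
      have h2 := mul_nonneg (sub_nonneg.2 h)
        (mul_nonneg (by linarith : 0 ≤ a + y) (sub_nonneg.2 hyb))
      have h3 : x * y + σ * (y - x) ≤ a * b + σ * (b - a) :=
        le_of_mul_le_mul_left (by linarith) (by linarith : 0 < y - θ)
      linarith
  have hyσ : 0 < y - σ := by linarith
  -- the point at height `y` on the hyperbola through the two pairs
  obtain ⟨x', hx'⟩ : ∃ x' : ℝ, (x' + σ) * (y - σ) = (c + σ) * (d - σ) :=
    ⟨(c + σ) * (d - σ) / (y - σ) - σ, by field_simp; ring⟩
  have hxx' : x ≤ x' := by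
    refine le_of_mul_le_mul_right ?_ hyσ
    linarith
  have hx'c : x' ≤ c := by
    refine le_of_mul_le_mul_right ?_ hyσ
    linarith [mul_le_mul_of_nonneg_left hdy.le (add_pos hc hσ0).le]
  have hax' : a ≤ x' := by
    refine le_of_mul_le_mul_right ?_ hyσ
    linarith [mul_le_mul_of_nonneg_left hyb (add_pos ha hσ0).le]
  have hx'y : (x', y) ∈ hullPairs K := by
    obtain ⟨t, ht⟩ : ∃ t : ℝ, t * ((b - a) - (d - c)) = (y - x') - (d - c) :=
      ⟨_, div_mul_cancel₀ _ hD.ne'⟩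
    have ht0 : 0 ≤ t := nonneg_of_mul_nonneg_left (by rw [ht]; linarith) hD
    have ht1 : t ≤ 1 := le_of_mul_le_mul_right (by linarith) hD
    have hmul : t * (c * d - a * b) = σ * ((y - x') - (d - c)) := by
      rw [← hσ, ← ht]; ring
    exact hullPairs_segment hp hq ha hab hcd hac.le (hdy.le.trans hyb) ht0 ht1 (hx.trans hxx')
      (by linarith) (by linarith) (by linarith)
  exact hullPairs_of_le hx'y (ha.trans_le hax') (by linarith) hx hxy le_rfl
    (mul_le_mul_of_nonneg_right hxx' (hx.trans hxy))

/-- Pairs satisfying all the inequalities belong to the hull. The interval `[0, y]` is covered by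
the closed sets of the slopes at which the inequality is witnessed by a point of `K` of height at least
`y`, or by one of height at most `y` with at least the product `x y`. -/
theorem mem_hullPairs {K : Set (ℝ × ℝ)} (hK : IsCompact K) (hne : K.Nonempty)
    (hT : ∀ p ∈ K, 0 ≤ p.1 ∧ p.1 ≤ p.2) (hpos : ∀ p ∈ K, 0 < p.1) {x y : ℝ} (hx : 0 ≤ x)
    (hxy : x ≤ y)
    (h : ∀ θ ∈ Set.Icc 0 (maxB K), x * y + θ * (y - x) ≤ maxM K θ) : (x, y) ∈ hullPairs K := by
  have hy0 := hx.trans hxy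
  obtain ⟨p₀, hp₀, e₀⟩ := exists_eq_maxB hK hne
  have hB : 0 < maxB K := e₀ ▸ (hpos p₀ hp₀).trans_le (hT p₀ hp₀).2
  -- at `θ = maxB K` the inequality becomes `(x + θ) (y - θ) ≤ 0`
  have hyB : y ≤ maxB K := by
    have := (h _ ⟨hB.le, le_rfl⟩).trans (maxM_maxB hK hne hpos hB.le)
    by_contra! hlt
    nlinarith
  have hclosed : ∀ S : Set (ℝ × ℝ), IsClosed S → IsClosed {θ : ℝ | θ ∈ Set.Icc 0 y ∧
      ∃ p ∈ K ∩ S, x * y + θ * (y - x) ≤ p.1 * p.2 + θ * (p.2 - p.1)} := by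
    intro S hS
    have hc : IsClosed {z : (ℝ × ℝ) × ℝ |
        x * y + z.2 * (y - x) ≤ z.1.1 * z.1.2 + z.2 * (z.1.2 - z.1.1)} :=
      isClosed_le (by fun_prop) (by fun_prop)
    convert ((((hK.inter_right hS).prod (isCompact_Icc (a := (0 : ℝ)) (b := y))).inter_right
      hc).image continuous_snd).isClosed using 1
    ext θ
    constructor
    · rintro ⟨hθ, p, hp, h⟩
      exact ⟨(p, θ), ⟨⟨hp, hθ⟩, h⟩, rfl⟩
    · rintro ⟨⟨p, _⟩, ⟨⟨hp, hθ⟩, h⟩, rfl⟩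
      exact ⟨hθ, p, hp, h⟩
  have hcover : ∀ θ ∈ Set.Icc 0 y,
      (∃ p ∈ K ∩ {p | y ≤ p.2}, x * y + θ * (y - x) ≤ p.1 * p.2 + θ * (p.2 - p.1)) ∨
      ∃ p ∈ K ∩ {p | p.2 ≤ y ∧ x * y ≤ p.1 * p.2},
        x * y + θ * (y - x) ≤ p.1 * p.2 + θ * (p.2 - p.1) := by
    intro θ hθ
    obtain ⟨p, hp, e⟩ := exists_eq_maxM hK hne θ
    have hpθ := e ▸ h θ ⟨hθ.1, hθ.2.trans hyB⟩
    rcases le_or_gt y p.2 with hyp | hyp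
    · exact .inl ⟨p, ⟨hp, hyp⟩, hpθ⟩
    -- a point below height `y` violates the inequality at slope `y`; as it satisfies it at `θ < y`,
    -- it also does so at slope `0`, both sides being affine in the slope
    · refine .inr ⟨p, ⟨hp, hyp.le, ?_⟩, hpθ⟩
      have h1 := mul_nonneg hy0 (sub_nonneg.2 hpθ)
      have h2 := mul_nonneg hθ.1
        (mul_nonneg (add_nonneg (hpos p hp).le hy0) (sub_nonneg.2 hyp.le))
      by_contra! hlt
      have h3 : θ < y := by
        refine hθ.2.lt_of_ne ?_
        rintro rfl
        have := mul_pos (add_pos_of_pos_of_nonneg (hpos p hp) hy0) (sub_pos.2 hyp)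
        linarith
      have h4 := mul_pos (sub_pos.2 h3) (sub_pos.2 hlt)
      linarith
  rcases hcover 0 ⟨le_rfl, hy0⟩ with ⟨p, ⟨hp, hyp⟩, h0⟩ | h0
  · exact hullPairs_of_le (subset_hullPairs K hp) (hpos p hp) (hT p hp).2 hx hxy hyp (by linarith)
  have htop : ∃ p ∈ K ∩ {p | y ≤ p.2}, x * y + y * (y - x) ≤ p.1 * p.2 + y * (p.2 - p.1) := by
    have hyp : y ≤ p₀.2 := hyB.trans_eq e₀.symm
    refine ⟨p₀, ⟨hp₀, hyp⟩, ?_⟩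
    have := mul_nonneg (add_nonneg (hpos p₀ hp₀).le hy0) (sub_nonneg.2 hyp)
    linarith
  obtain ⟨θ, hθ, ⟨-, ⟨a, b⟩, ⟨hp, hyb⟩, hpθ⟩, -, ⟨c, d⟩, ⟨hq, hdy, hxq⟩, hqθ⟩ :=
    isPreconnected_closed_iff.1 (isPreconnected_Icc (a := (0 : ℝ)) (b := y)) _ _
      (hclosed {p | y ≤ p.2} (isClosed_le continuous_const continuous_snd))
      (hclosed {p | p.2 ≤ y ∧ x * y ≤ p.1 * p.2}
        ((isClosed_le continuous_snd continuous_const).inter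
          (isClosed_le continuous_const (continuous_fst.mul continuous_snd))))
      (fun θ hθ => (hcover θ hθ).imp (fun h => ⟨hθ, h⟩) fun h => ⟨hθ, h⟩)
      ⟨y, ⟨hy0, le_rfl⟩, ⟨hy0, le_rfl⟩, htop⟩ ⟨0, ⟨le_rfl, hy0⟩, ⟨le_rfl, hy0⟩, h0⟩
  exact mem_hullPairs_of_two (subset_hullPairs K hp) (subset_hullPairs K hq) (hpos _ hp)
    (hT _ hp).2 (hpos _ hq) (hT _ hq).2 hx hxy hyb hdy hθ.2 hxq hpθ hqθ

/-! ### Polyconvex functions separating the hull -/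

theorem Polyconvex.rankOneConvex {f : Mat → EReal} (hf : Polyconvex f) : RankOneConvex f := by
  obtain ⟨g, hg, e⟩ := hf
  refine ⟨fun ξ => by rw [e]; exact hg.1 _, fun A B h t h0 h1 => ?_⟩
  have := hg.2 (A, A.det) (B, B.det) t h0 h1
  rw [e, e A, e B, det_segment ((rank_le_one_iff_det_eq_zero _).1 h)]
  exact this

theorem Rco_subset_Pco (E : Set Mat) : Rco E ⊆ Pco E := fun _ hξ f hf hE =>
  hξ f hf.rankOneConvex hE

theorem extConvex_of_convexOn {V : Type*} [AddCommGroup V] [Module ℝ V] {g : V → ℝ}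
    (hg : ConvexOn ℝ Set.univ g) : ExtConvex fun v => (g v : EReal) := by
  refine ⟨fun v => EReal.coe_ne_bot _, fun v w t h0 h1 => ?_⟩
  have := hg.2 (Set.mem_univ v) (Set.mem_univ w) h0 (sub_nonneg.2 h1) (by ring)
  rw [← EReal.coe_mul, ← EReal.coe_mul, ← EReal.coe_add]
  exact EReal.coe_le_coe this

/-- Real convex functions of the matrix and its determinant which are nonpositive on `E` are
nonpositive on the polyconvex hull. -/
theorem Pco_bound {E : Set Mat} {g : Mat × ℝ → ℝ} (hg : ConvexOn ℝ Set.univ g)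
    (hE : ∀ η ∈ E, g (η, η.det) ≤ 0) {ξ : Mat} (hξ : ξ ∈ Pco E) : g (ξ, ξ.det) ≤ 0 :=
  EReal.coe_nonpos.1 (hξ (fun η => (g (η, η.det) : EReal))
    ⟨fun v => (g v : EReal), extConvex_of_convexOn hg, fun _ => rfl⟩
    fun η hη => EReal.coe_nonpos.2 (hE η hη))

theorem convexOn_norm_linear_add (L : Mat →ₗ[ℝ] ℂ) {θ : ℝ} (hθ : 0 ≤ θ) (s m : ℝ) :
    ConvexOn ℝ Set.univ fun v : Mat × ℝ => s * v.2 + 2 * θ * ‖L v.1‖ - m := by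
  have h1 : ConvexOn ℝ Set.univ fun v : Mat × ℝ => ‖L v.1‖ :=
    (convexOn_norm convex_univ).comp_linearMap (L ∘ₗ LinearMap.fst ℝ Mat ℝ)
  have h2 : ConvexOn ℝ Set.univ fun v : Mat × ℝ => s * v.2 :=
    (s • LinearMap.snd ℝ Mat ℝ).convexOn convex_univ
  have h3 := (h2.add (h1.smul (by positivity : 0 ≤ 2 * θ))).add_const (-m)
  exact h3

/-- The value at a point of `K` of the polyconvex function attached to the other sign of the
determinant. -/
theorem neg_mul_add_le_maxM {K : Set (ℝ × ℝ)} (hK : IsCompact K) (hne : K.Nonempty)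
    (hpos : ∀ p ∈ K, 0 < p.1) {θ : ℝ} (hθ : θ ∈ Set.Icc 0 (maxB K)) {p : ℝ × ℝ}
    (hp : p ∈ K) (hab : p.1 ≤ p.2) :
    -(p.1 * p.2) + θ * (p.1 + p.2) ≤ maxM K θ := by
  have ha := hpos p hp
  rcases le_total θ p.2 with h | h
  · linarith [le_maxM hK hp θ, mul_nonneg ha.le (sub_nonneg.2 h)]
  · have := mul_nonneg (sub_nonneg.2 h) (sub_nonneg.2 (hab.trans h))
    linarith [sq_le_maxM hK hne hpos hθ]

theorem isoSet_bound {K : Set (ℝ × ℝ)} (hK : IsCompact K) (hne : K.Nonempty)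
    (hpos : ∀ p ∈ K, 0 < p.1) {θ : ℝ} (hθ : θ ∈ Set.Icc 0 (maxB K)) {ξ : Mat}
    (hξ : ξ ∈ isoSet K) :
    ξ.det + 2 * θ * ‖antiPart ξ‖ ≤ maxM K θ ∧ -ξ.det + 2 * θ * ‖confPart ξ‖ ≤ maxM K θ := by
  have h1 := le_maxM hK hξ θ
  have h2 := neg_mul_add_le_maxM hK hne hpos hθ hξ (sing1_le_sing2 ξ)
  have h3 := sing1_mul_sing2 ξ
  have h4 := (sing_eq_norm_parts ξ).2
  simp only at h1 h2
  rcases le_total 0 ξ.det with h | h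
  · have h5 := sing1_of_det_nonneg h
    rw [abs_of_nonneg h] at h3
    rw [h3] at h1 h2
    rw [h5, h4] at h1 h2
    constructor <;> linarith
  · have h5 := sing1_of_det_nonpos h
    rw [abs_of_nonpos h] at h3
    rw [h3] at h1 h2
    rw [h5, h4] at h1 h2
    constructor <;> linarith

theorem Pco_isoSet_le {K : Set (ℝ × ℝ)} (hK : IsCompact K) (hne : K.Nonempty)
    (hpos : ∀ p ∈ K, 0 < p.1) {ξ : Mat} (hξ : ξ ∈ Pco (isoSet K)) {θ : ℝ}
    (hθ : θ ∈ Set.Icc 0 (maxB K)) :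
    sing1 ξ * sing2 ξ + θ * (sing2 ξ - sing1 ξ) ≤ maxM K θ := by
  have h1 := Pco_bound (convexOn_norm_linear_add antiPart hθ.1 1 (maxM K θ))
    (fun η hη => by linarith [(isoSet_bound hK hne hpos hθ hη).1]) hξ
  have h2 := Pco_bound (convexOn_norm_linear_add confPart hθ.1 (-1) (maxM K θ))
    (fun η hη => by linarith [(isoSet_bound hK hne hpos hθ hη).2]) hξ
  simp only at h1 h2
  rw [sing1_mul_sing2, (sing_eq_norm_parts ξ).2]
  rcases le_total 0 ξ.det with h | h
  · rw [sing1_of_det_nonneg h, abs_of_nonneg h]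
    linarith
  · rw [sing1_of_det_nonpos h, abs_of_nonpos h]
    linarith

/-! ### The hull and its interior -/

theorem Rco_isoSet_eq {K : Set (ℝ × ℝ)} (hK : IsCompact K) (hne : K.Nonempty)
    (hT : ∀ p ∈ K, 0 ≤ p.1 ∧ p.1 ≤ p.2) (hpos : ∀ p ∈ K, 0 < p.1) :
    Rco (isoSet K) = {ξ | ∀ θ ∈ Set.Icc 0 (maxB K),
      sing1 ξ * sing2 ξ + θ * (sing2 ξ - sing1 ξ) ≤ maxM K θ} :=
  Set.Subset.antisymm (fun _ hξ _ hθ => Pco_isoSet_le hK hne hpos (Rco_subset_Pco _ hξ) hθ)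
    fun ξ h => mem_hullPairs hK hne hT hpos (sing1_nonneg ξ) (sing1_le_sing2 ξ) h ξ rfl rfl

theorem isOpen_setOf_lt_maxM {K : Set (ℝ × ℝ)} (hK : IsCompact K) :
    IsOpen {ξ : Mat | ∀ θ ∈ Set.Icc 0 (maxB K),
      sing1 ξ * sing2 ξ + θ * (sing2 ξ - sing1 ξ) < maxM K θ} := by
  have h1 := continuous_sing1
  have h2 := continuous_sing2
  have h3 := continuous_maxM hK
  have ho : IsOpen {z : Mat × ℝ | sing1 z.1 * sing2 z.1 + z.2 * (sing2 z.1 - sing1 z.1) <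
      maxM K z.2} := isOpen_lt (by fun_prop) (by fun_prop)
  exact isOpen_iff_eventually.2 fun ξ hξ => isCompact_Icc.eventually_forall_of_forall_eventually
    fun θ hθ => ho.mem_nhds (hξ θ hθ)

theorem interior_Rco_isoSet_eq {K : Set (ℝ × ℝ)} (hK : IsCompact K) (hne : K.Nonempty)
    (hT : ∀ p ∈ K, 0 ≤ p.1 ∧ p.1 ≤ p.2) (hpos : ∀ p ∈ K, 0 < p.1) :
    interior (Rco (isoSet K)) = {ξ | ∀ θ ∈ Set.Icc 0 (maxB K),
      sing1 ξ * sing2 ξ + θ * (sing2 ξ - sing1 ξ) < maxM K θ} := by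
  rw [Rco_isoSet_eq hK hne hT hpos]
  refine Set.Subset.antisymm (fun ξ hξ θ hθ => ?_)
    (interior_maximal (fun ξ h θ hθ => (h θ hθ).le) (isOpen_setOf_lt_maxM hK))
  have hc : Filter.Tendsto (fun t : ℝ => t • ξ) (nhdsWithin 1 (Set.Ioi 1)) (nhds ξ) := by
    have : Continuous fun t : ℝ => t • ξ := by fun_prop
    simpa using (this.tendsto 1).mono_left nhdsWithin_le_nhds
  obtain ⟨t, hmem, ht : 1 < t⟩ :=
    ((hc.eventually (mem_interior_iff_mem_nhds.1 hξ)).and self_mem_nhdsWithin).exists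
  have h := hmem θ hθ
  obtain ⟨e1, e2⟩ := sing_smul ξ (zero_le_one.trans ht.le)
  rw [e1, e2] at h
  have hM := maxM_pos hK hne hT hpos hθ.1
  -- equality at `ξ` fails at `t • ξ`, since the left side grows at least by the factor `t`
  by_contra! hle
  set u := sing1 ξ * sing2 ξ
  set F := u + θ * (sing2 ξ - sing1 ξ) with hF
  have hu : 0 ≤ u := mul_nonneg (sing1_nonneg ξ) (sing2_nonneg ξ)
  have h1 : F < t * F := by
    have := mul_pos (sub_pos.2 ht) (hM.trans_le hle)
    linarith
  have h2 : t * u ≤ t * (t * u) := by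
    have := mul_nonneg (sub_nonneg.2 ht.le) (mul_nonneg (zero_le_one.trans ht.le) hu)
    linarith
  have h3 : t * sing1 ξ * (t * sing2 ξ) = t * (t * u) := by ring
  rw [h3] at h
  have h4 : t * F = t * u + θ * (t * sing2 ξ - t * sing1 ξ) := by rw [hF]; ring
  linarith

end IsotropicHull

theorem mainTheorem2 (K : Set (ℝ × ℝ)) (hcompact : IsCompact K) (hnonempty : K.Nonempty)
    (hT : ∀ p ∈ K, 0 ≤ p.1 ∧ p.1 ≤ p.2) (hpos : ∀ p ∈ K, 0 < p.1) :
    IsotropicHull.Rco (IsotropicHull.isoSet K) =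
        {ξ : Matrix (Fin 2) (Fin 2) ℝ | ∀ θ ∈ Set.Icc 0 (IsotropicHull.maxB K),
          IsotropicHull.sing1 ξ * IsotropicHull.sing2 ξ +
            θ * (IsotropicHull.sing2 ξ - IsotropicHull.sing1 ξ) ≤ IsotropicHull.maxM K θ} ∧
      interior (IsotropicHull.Rco (IsotropicHull.isoSet K)) =
        {ξ : Matrix (Fin 2) (Fin 2) ℝ | ∀ θ ∈ Set.Icc 0 (IsotropicHull.maxB K),
          IsotropicHull.sing1 ξ * IsotropicHull.sing2 ξ +
            θ * (IsotropicHull.sing2 ξ - IsotropicHull.sing1 ξ) < IsotropicHull.maxM K θ} ∧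
      IsotropicHull.Rco (IsotropicHull.isoSet K) =
        IsotropicHull.Pco (IsotropicHull.isoSet K) := by
  refine ⟨IsotropicHull.Rco_isoSet_eq hcompact hnonempty hT hpos,
    IsotropicHull.interior_Rco_isoSet_eq hcompact hnonempty hT hpos,
    (IsotropicHull.Rco_subset_Pco _).antisymm fun ξ hξ => ?_⟩
  rw [IsotropicHull.Rco_isoSet_eq hcompact hnonempty hT hpos]
  exact fun θ hθ => IsotropicHull.Pco_isoSet_le hcompact hnonempty hpos hξ hθ
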